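/- All graphs are finite and simple. A tree decomposition of a graph $G$ is a tree $T$ with a family $(W_t)_{t\in V(T)}$ of subsets of $V(G)$ such that every vertex of $G$ lies in some $W_t$, every edge of $G$ has both endpoints in some $W_t$, and for every vertex $v$ the set $\{t : v\in W_t\}$ induces a subtree of $T$. Its width is $\max_t |W_t|-1$, and the treewidth $tw(G)$ is the minimum width of a tree decomposition of $G$. Let $\Delta(G)$ be the maximum degree of $G$. Let $c_\infty(G)$ be the cop number of $G$ against a robber of unbounded speed, that is, the least $k$ such that $k$ cops have a winning strategy in the following game with perfect information. First the cops are placed at vertices of $G$ (several cops may share a vertex), then the robber chooses a vertex. After that the two sides move alternately, the cops first. In the cops' turn, each cop stays or moves to an adjacent vertex; in the robber's turn, she stays or moves along any path of $G$ that contains no vertex occupied by a cop. The cops win if eventually a cop moves to the robber's current vertex; the robber wins if this never happens. **Theorem.** For every connected graph $G$ (with at least one vertex), $$\frac{tw(G)+1}{\Delta(G)+1}\;\le\; c_\infty(G)\;\le\; tw(G)+1,$$ and both bounds are tight: 1. for every $n\ge 1$, the complete graph $K_n$ has $tw(K_n)=\Delta(K_n)=n-1$ and $c_\infty(K_n)=1$,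 so that $\frac{tw(K_n)+1}{\Delta(K_n)+1}=c_\infty(K_n)$; 2. for every $m\ge 4$, let $G_m$ be the graph formed from $m$ independent vertices by joining every two of them by $m$ internally disjoint paths of length $3$ (paths for different pairs also being internally disjoint), with no other edges. Then $G_m$ is connected, $tw(G_m)=m-1$ and $c_\infty(G_m)=m=tw(G_m)+1$. -/

import Mathlib

namespace CopsRobber

/-! ### Tree decompositions and treewidth -/

/-- A tree decomposition of `G` whose tree has node set `ι`. -/
structure TreeDecomposition {V : Type*} (G : SimpleGraph V) (ι : Type*) where
  /-- the tree -/
  tree : SimpleGraph ι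
  isTree : tree.IsTree
  /-- the family of bags `W t` -/
  bag : ι → Finset V
  vertex_mem : ∀ v : V, ∃ t, v ∈ bag t
  edge_mem : ∀ u v : V, G.Adj u v → ∃ t, u ∈ bag t ∧ v ∈ bag t
  /-- The nodes whose bag contains `v` induce a connected subgraph of the tree, i.e. a subtree. -/
  subtree : ∀ v : V, (tree.induce {t | v ∈ bag t}).Connected

/-- The width `max {|W t| - 1}`. (If `G` has a vertex then some bag is nonempty, so the
subtraction is not truncated.) -/
def TreeDecomposition.width {V : Type*} {G : SimpleGraph V} {ι : Type*} [Fintype ι]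
    (D : TreeDecomposition G ι) : ℕ :=
  (Finset.univ.sup fun t => (D.bag t).card) - 1

/-- The treewidth: the minimum width of a tree decomposition over a finite tree. -/
noncomputable def treewidth {V : Type*} (G : SimpleGraph V) : ℕ :=
  sInf {w | ∃ (ι : Type) (_ : Fintype ι) (D : TreeDecomposition G ι), D.width = w}

/-! ### The Cops and Robber game with a robber of unbounded speed -/

/-- With the cops standing at the vertices `C i`, the robber can go from `u` to `v` in one turn:
she moves along edges through vertices that are not occupied by cops (staying put is the
walk of length zero). -/
def RobberMove {V : Type*} (G : SimpleGraph V) {k : ℕ} (C : Fin k → V) (u v : V) : Prop :=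
  ∃ p : G.Walk u v, ∀ x ∈ p.support, ∀ i, C i ≠ x

/-- A (history-dependent) strategy of `k` cops. The robber's positions seen so far are listed with
the latest one first: `pos []` is the initial placement of the cops, which is chosen before the
robber chooses her starting vertex, and `pos (v :: h)` is where the cops stand after their answer
to the robber's latest position `v`. Several cops may stand at the same vertex. -/
structure CopStrategy {V : Type*} (G : SimpleGraph V) (k : ℕ) where
  pos : List V → Fin k → V
  /-- Each cop stays where it is or moves to an adjacent vertex. -/
  legal : ∀ (h : List V) (v : V) (i : Fin k),
    pos (v :: h) i = pos h i ∨ G.Adj (pos h i) (pos (v :: h) i)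

/-- The first `n` entries `r 0, …, r (n - 1)` of a sequence, the latest one first. -/
def history {V : Type*} (r : ℕ → V) : ℕ → List V
  | 0 => []
  | n + 1 => r n :: history r n

/-- When the robber follows `r` (starting at `r 0`), some cop moves in the cops' `n`-th turn
(counted from `0`) to the robber's current vertex `r n`. -/
def CopStrategy.Captures {V : Type*} {G : SimpleGraph V} {k : ℕ} (σ : CopStrategy G k)
    (r : ℕ → V) (n : ℕ) : Prop :=
  ∃ i, σ.pos (history r (n + 1)) i = r n

/-- The strategy is winning: whatever vertex the robber starts at, and whatever legal moves
she makes as long as she is not captured, she is captured eventually. -/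
def CopStrategy.IsWinning {V : Type*} {G : SimpleGraph V} {k : ℕ} (σ : CopStrategy G k) : Prop :=
  ∀ r : ℕ → V,
    (∀ n, ¬ σ.Captures r n → RobberMove G (σ.pos (history r (n + 1))) (r n) (r (n + 1))) →
    ∃ n, σ.Captures r n

/-- The cop number of `G` against a robber of unbounded speed: the minimum number of cops that
have a winning strategy. -/
noncomputable def copNumber {V : Type*} (G : SimpleGraph V) : ℕ :=
  sInf {k | ∃ σ : CopStrategy G k, σ.IsWinning}

/-! ### `m` vertices, every two of them joined by `m` disjoint paths of length 3 -/

/-- `inl i` is the branch vertex `v i`. For `i < j` and `l : Fin m`, the `l`-th path between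
`v i` and `v j` is `v i`, `inr ((i, j), l, false)`, `inr ((i, j), l, true)`, `v j`. -/
abbrev ThreePathVertex (m : ℕ) : Type :=
  Fin m ⊕ ({p : Fin m × Fin m // p.1 < p.2} × Fin m × Bool)

/-- The edges of these paths, in one of their two directions at least. -/
def threePathRel (m : ℕ) : ThreePathVertex m → ThreePathVertex m → Prop
  | .inl i, .inr (p, _, false) => i = p.1.1
  | .inl j, .inr (p, _, true) => j = p.1.2
  | .inr (p, l, false), .inr (q, l', true) => p = q ∧ l = l'
  | _, _ => False

/-- The graph with `m` branch vertices, every two of which are joined by `m` internally disjoint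
paths of length 3, and with no other edges. -/
def threePathGraph (m : ℕ) : SimpleGraph (ThreePathVertex m) :=
  SimpleGraph.fromRel (threePathRel m)

end CopsRobber

namespace CopsRobber

/-! ### Walks inside a set of vertices -/

/-! Lower bound: by bramble duality, if k cops satisfy k(Δ+1) < tw+1, some bramble is not covered by
any k(Δ+1) vertices. The closed neighbourhoods of the cops contain at most that many vertices, so
they always miss some member. The robber sits in such a member. The cops cannot enter it in one
turn, and after their move she runs through it, and across a touching pair, into a member that is
safe next (`CopStrategy.IsWinning.treewidth_add_one_le`).

The hard half of duality is proved by reverse induction on brambles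
(`IsBramble.exists_treeDecomposition`). Take a minimum cover X of the bramble, decompose X together
with each component C of G - X, and glue along X. Either C fails to touch some member and two bags
suffice, or adding C gives a larger bramble, whose decomposition is restricted to X ∪ C. Minimality
of X keeps the restricted bags small (`Admits.of_treeDecomposition`).

Upper bound: tw+1 cops fill a bag and move to the next bag towards the robber. Those on common
vertices stay put; these vertices separate, so the robber's territory shrinks
(`TreeDecomposition.exists_side_ssubset`, `TreeDecomposition.wins`). The same descent gives a bag
containing all of a complete graph.

For the path graphs no lower bound on the treewidth is proved directly: a star decomposition gives
tw+1 ≤ m, a robber strategy gives m ≤ c, and c ≤ tw+1 closes the circle. -/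

/-- There is a walk from `u` to `v` all of whose vertices lie in `S`. -/
def WalkIn {V : Type*} (G : SimpleGraph V) (S : Set V) (u v : V) : Prop :=
  ∃ p : G.Walk u v, ∀ x ∈ p.support, x ∈ S

namespace WalkIn

variable {V : Type*} {G : SimpleGraph V} {S T : Set V} {u v w : V}

theorem refl (h : u ∈ S) : WalkIn G S u u := ⟨.nil, by simpa using h⟩

theorem symm (h : WalkIn G S u v) : WalkIn G S v u := by
  obtain ⟨p, hp⟩ := h
  exact ⟨p.reverse, by simpa using hp⟩

theorem trans (h : WalkIn G S u v) (h' : WalkIn G S v w) : WalkIn G S u w := by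
  obtain ⟨p, hp⟩ := h
  obtain ⟨q, hq⟩ := h'
  refine ⟨p.append q, fun x hx => ?_⟩
  rw [SimpleGraph.Walk.mem_support_append_iff] at hx
  exact hx.elim (hp x) (hq x)

theorem of_adj (h : G.Adj u v) (hu : u ∈ S) (hv : v ∈ S) : WalkIn G S u v :=
  ⟨h.toWalk, by simp [hu, hv]⟩

theorem left_mem (h : WalkIn G S u v) : u ∈ S := h.elim fun p hp => hp u p.start_mem_support

theorem right_mem (h : WalkIn G S u v) : v ∈ S := h.elim fun p hp => hp v p.end_mem_support

theorem mono (hST : S ⊆ T) (h : WalkIn G S u v) : WalkIn G T u v :=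
  h.elim fun p hp => ⟨p, fun x hx => hST (hp x hx)⟩

/-- A property that holds at the start of a walk and is preserved by its steps holds at the end. -/
theorem induct {P : V → Prop} (h : WalkIn G S u v) (hu : P u)
    (hstep : ∀ x y, x ∈ S → y ∈ S → G.Adj x y → P x → P y) : P v := by
  obtain ⟨p, hp⟩ := h
  induction p with
  | nil => exact hu
  | cons hadj p ih =>
    simp only [SimpleGraph.Walk.support_cons, List.mem_cons, forall_eq_or_imp] at hp
    exact ih (hstep _ _ hp.1 (hp.2 _ p.start_mem_support) hadj hu) hp.2

theorem of_support (p : G.Walk u v) (hw : w ∈ p.support) : WalkIn G {x | x ∈ p.support} u w := by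
  classical
  exact ⟨p.takeUntil w hw, fun x hx => p.support_takeUntil_subset_support hw hx⟩

/-- A walk inside `T` that leaves `S` has a last vertex in `S`, followed by a vertex outside it;
the rest of the walk stays outside `S`. -/
theorem exists_exit (h : WalkIn G T u v) (hu : u ∈ S) (hv : v ∉ S) :
    ∃ x y, x ∈ S ∧ x ∈ T ∧ G.Adj x y ∧ WalkIn G (T \ S) y v := by
  have key : WalkIn G (T \ S) u v ∨
      ∃ x y, x ∈ S ∧ x ∈ T ∧ G.Adj x y ∧ WalkIn G (T \ S) y v := by
    refine h.symm.induct (P := fun z => WalkIn G (T \ S) z v ∨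
      ∃ x y, x ∈ S ∧ x ∈ T ∧ G.Adj x y ∧ WalkIn G (T \ S) y v)
      (.inl (refl ⟨h.right_mem, hv⟩)) ?_
    rintro x y - hy hadj (hx | hx)
    · by_cases hyS : y ∈ S
      · exact .inr ⟨y, x, hyS, hy, hadj.symm, hx⟩
      · exact .inl ((of_adj (S := T \ S) hadj.symm ⟨hy, hyS⟩ hx.left_mem).trans hx)
    · exact .inr hx
  exact key.resolve_left fun h' => h'.left_mem.2 hu

theorem induce_connected_iff :
    (G.induce S).Connected ↔ S.Nonempty ∧ ∀ u ∈ S, ∀ v ∈ S, WalkIn G S u v := by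
  constructor
  · intro h
    refine ⟨Set.nonempty_coe_sort.mp h.nonempty, fun u hu v hv => ?_⟩
    obtain ⟨p⟩ := h.preconnected ⟨u, hu⟩ ⟨v, hv⟩
    refine ⟨p.map (SimpleGraph.Embedding.induce S).toHom, fun x hx => ?_⟩
    have hx' : x ∈ p.support.map (SimpleGraph.Embedding.induce (G := G) S).toHom := by
      rwa [← SimpleGraph.Walk.support_map]
    obtain ⟨y, -, rfl⟩ := List.mem_map.mp hx'
    exact y.2
  · rintro ⟨hne, h⟩
    have : Nonempty S := hne.to_subtype
    refine ⟨fun u v => ?_⟩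
    obtain ⟨p, hp⟩ := h u u.2 v v.2
    exact ⟨p.induce S hp⟩

end WalkIn

/-! ### Walks in trees -/

section Tree

variable {ι : Type*} {T : SimpleGraph ι} {a b s t : ι}

/-- Paths in a forest are unique, so deleting the detours of `q` leaves exactly `p`. -/
theorem support_subset_of_isPath (hT : T.IsAcyclic) {p : T.Walk a b} (hp : p.IsPath)
    (q : T.Walk a b) : p.support ⊆ q.support := by
  classical
  have h := congrArg Subtype.val
    ((hT.subsingleton_path a b).elim ⟨p, hp⟩ ⟨q.bypass, q.bypass_isPath⟩)
  rw [show p = q.bypass from h]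
  exact q.support_bypass_subset_support

/-- In a tree, a walk that reaches a neighbour `s` of `t` without meeting `t` starts on the side
of `s`, so that every walk from its start to `t` meets `s`. -/
theorem not_walkIn_of_walkIn (hT : T.IsAcyclic) (hadj : T.Adj t s)
    (h : WalkIn T {x | x ≠ t} b s) : ¬ WalkIn T {x | x ≠ s} b t := by
  classical
  rintro ⟨q, hq⟩
  obtain ⟨p, hp⟩ := h
  have hpt : t ∉ p.bypass.support := fun hmem => hp t (p.support_bypass_subset_support hmem) rfl
  -- Extended by the edge to `t`, the path through `s` is the unique path from `b` to `t`, so `q`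
  -- must meet `s`.
  have hpath := p.bypass_isPath.concat hpt hadj.symm
  refine hq s (support_subset_of_isPath hT hpath q ?_) rfl
  simp [SimpleGraph.Walk.support_concat]

end Tree

/-! ### Partial tree decompositions -/

/-- A tree decomposition of the subgraph of `G` induced by `A`, with bags in the vertex type of
`G`. -/
structure PartialDecomposition {V : Type*} (G : SimpleGraph V) (A : Set V) (ι : Type*) where
  tree : SimpleGraph ι
  isTree : tree.IsTree
  bag : ι → Finset V
  bag_subset : ∀ t, ∀ v ∈ bag t, v ∈ A
  vertex_mem : ∀ v ∈ A, ∃ t, v ∈ bag t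
  edge_mem : ∀ u ∈ A, ∀ v ∈ A, G.Adj u v → ∃ t, u ∈ bag t ∧ v ∈ bag t
  subtree : ∀ v a b, v ∈ bag a → v ∈ bag b → WalkIn tree {t | v ∈ bag t} a b

theorem TreeDecomposition.walkIn {V ι : Type*} {G : SimpleGraph V} (D : TreeDecomposition G ι)
    {v : V} {a b : ι} (ha : v ∈ D.bag a) (hb : v ∈ D.bag b) :
    WalkIn D.tree {t | v ∈ D.bag t} a b :=
  (WalkIn.induce_connected_iff.mp (D.subtree v)).2 a ha b hb

/-- A walk of `G` that avoids the bag of `t` gives rise to a walk of the tree that avoids `t`. -/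
theorem TreeDecomposition.walkIn_compl {V ι : Type*} {G : SimpleGraph V}
    (D : TreeDecomposition G ι) {S : Set V} {u v : V} {a b t : ι} (h : WalkIn G S u v)
    (hS : ∀ x ∈ S, x ∉ D.bag t) (ha : u ∈ D.bag a) (hb : v ∈ D.bag b) :
    WalkIn D.tree {c | c ≠ t} a b := by
  have hsub : ∀ x ∈ S, ∀ c d, x ∈ D.bag c → x ∈ D.bag d → WalkIn D.tree {c | c ≠ t} c d :=
    fun x hx c d hc hd => (D.walkIn hc hd).mono fun e he => by
      rintro rfl
      exact hS x hx he
  refine h.induct (P := fun x => ∀ c, x ∈ D.bag c → WalkIn D.tree {c | c ≠ t} a c)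
    (fun c hc => hsub u h.left_mem a c ha hc) ?_ b hb
  intro x y _ hy hxy hx c hc
  obtain ⟨d, hxd, hyd⟩ := D.edge_mem x y hxy
  exact (hx d hxd).trans (hsub y hy d c hyd hc)

/-- A walk of `G` from the bag of `a` to the bag of `b` meets all bags on the path of the tree
from `a` to `b`. -/
theorem TreeDecomposition.exists_mem_bag {V ι : Type*} {G : SimpleGraph V}
    (D : TreeDecomposition G ι) {S : Set V} {u v : V} {a b t : ι} {p : D.tree.Walk a b}
    (hp : p.IsPath) (ht : t ∈ p.support) (h : WalkIn G S u v) (ha : u ∈ D.bag a)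
    (hb : v ∈ D.bag b) : ∃ z ∈ S, z ∈ D.bag t := by
  by_contra! hS
  obtain ⟨q, hq⟩ := D.walkIn_compl h hS ha hb
  exact hq t (support_subset_of_isPath D.isTree.isAcyclic hp q ht) rfl

/-- A walk never changes summand, so an edge that is a bridge of its summand remains a bridge of the
sum. -/
theorem isAcyclic_sum {V W : Type*} {G : SimpleGraph V} {H : SimpleGraph W} (hG : G.IsAcyclic)
    (hH : H.IsAcyclic) : (G ⊕g H).IsAcyclic := by
  rw [SimpleGraph.isAcyclic_iff_forall_adj_isBridge] at hG hH ⊢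
  rintro (a | a) (b | b) hab
  · refine SimpleGraph.isBridge_iff.mpr fun ⟨p⟩ => ?_
    have h := WalkIn.induct (S := Set.univ) (P := fun x => ∃ c, x = .inl c ∧
      (G.deleteEdges {s(a, b)}).Reachable a c) ⟨p, fun _ _ => trivial⟩ ⟨a, rfl, .rfl⟩ ?_
    · obtain ⟨c, hc, hac⟩ := h
      cases hc
      exact hG hab hac
    · rintro _ (y | y) - - hxy ⟨c, rfl, hac⟩
      · refine ⟨y, rfl, hac.trans (SimpleGraph.Adj.reachable ?_)⟩
        simpa using hxy
      · simp at hxy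
  · simp at hab
  · simp at hab
  · refine SimpleGraph.isBridge_iff.mpr fun ⟨p⟩ => ?_
    have h := WalkIn.induct (S := Set.univ) (P := fun x => ∃ c, x = .inr c ∧
      (H.deleteEdges {s(a, b)}).Reachable a c) ⟨p, fun _ _ => trivial⟩ ⟨a, rfl, .rfl⟩ ?_
    · obtain ⟨c, hc, hac⟩ := h
      cases hc
      exact hH hab hac
    · rintro _ (y | y) - - hxy ⟨c, rfl, hac⟩
      · simp at hxy
      · refine ⟨y, rfl, hac.trans (SimpleGraph.Adj.reachable ?_)⟩
        simpa using hxy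

namespace PartialDecomposition

variable {V : Type*} {G : SimpleGraph V} {A A' : Set V} {ι ι' : Type*}

/-- The decomposition with a single bag. -/
def single (G : SimpleGraph V) (X : Finset V) : PartialDecomposition G X Unit where
  tree := ⊥
  isTree := .of_subsingleton
  bag _ := X
  bag_subset _ _ h := h
  vertex_mem _ h := ⟨(), h⟩
  edge_mem _ hu _ hv _ := ⟨(), hu, hv⟩
  subtree _ _ _ ha _ := WalkIn.refl ha

/-- A partial tree decomposition whose vertex set is everything is a tree decomposition. -/
def toTreeDecomposition (D : PartialDecomposition G A ι) (hA : ∀ v, v ∈ A) :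
    TreeDecomposition G ι where
  tree := D.tree
  isTree := D.isTree
  bag := D.bag
  vertex_mem v := D.vertex_mem v (hA v)
  edge_mem u v h := D.edge_mem u (hA u) v (hA v) h
  subtree v := WalkIn.induce_connected_iff.mpr
    ⟨D.vertex_mem v (hA v), fun a ha b hb => D.subtree v a b ha hb⟩

/-- Two partial tree decompositions are joined by an edge between two of their nodes, the bags of
which contain the common vertices. -/
def glue (D : PartialDecomposition G A ι) (D' : PartialDecomposition G A' ι') (s : ι) (s' : ι')
    (hsep : ∀ v ∈ A, v ∈ A' → v ∈ D.bag s ∧ v ∈ D'.bag s')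
    (hedge : ∀ u ∈ A, ∀ v ∈ A', G.Adj u v → u ∈ A' ∨ v ∈ A) :
    PartialDecomposition G (A ∪ A') (ι ⊕ ι') where
  tree := (D.tree ⊕g D'.tree) ⊔ SimpleGraph.edge (.inl s) (.inr s')
  isTree := ⟨D.isTree.connected.sum_sup_edge D'.isTree.connected, by
    refine SimpleGraph.IsAcyclic.sup_edge_of_not_reachable
      (SimpleGraph.not_reachable_sum_inl_inr s s') ?_
    exact isAcyclic_sum D.isTree.isAcyclic D'.isTree.isAcyclic⟩
  bag := Sum.elim D.bag D'.bag
  bag_subset := by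
    rintro (t | t) v hv
    · exact .inl (D.bag_subset t v hv)
    · exact .inr (D'.bag_subset t v hv)
  vertex_mem := by
    rintro v (hv | hv)
    · exact (D.vertex_mem v hv).elim fun t ht => ⟨.inl t, ht⟩
    · exact (D'.vertex_mem v hv).elim fun t ht => ⟨.inr t, ht⟩
  edge_mem := by
    have hl : ∀ u ∈ A, ∀ v ∈ A, G.Adj u v →
        ∃ t, u ∈ Sum.elim D.bag D'.bag t ∧ v ∈ Sum.elim D.bag D'.bag t := fun u hu v hv h =>
      (D.edge_mem u hu v hv h).elim fun t ht => ⟨.inl t, ht⟩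
    have hr : ∀ u ∈ A', ∀ v ∈ A', G.Adj u v →
        ∃ t, u ∈ Sum.elim D.bag D'.bag t ∧ v ∈ Sum.elim D.bag D'.bag t := fun u hu v hv h =>
      (D'.edge_mem u hu v hv h).elim fun t ht => ⟨.inr t, ht⟩
    rintro u (hu | hu) v (hv | hv) h
    · exact hl u hu v hv h
    · rcases hedge u hu v hv h with h' | h'
      exacts [hr u h' v hv h, hl u hu v h' h]
    · rcases hedge v hv u hu h.symm with h' | h'
      exacts [hr u hu v h' h, hl u h' v hv h]
    · exact hr u hu v hv h
  subtree := by
    intro v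
    set T := (D.tree ⊕g D'.tree) ⊔ SimpleGraph.edge (.inl s) (.inr s') with hT
    set S : Set (ι ⊕ ι') := {t | v ∈ Sum.elim D.bag D'.bag t} with hS
    have hl : ∀ a b, v ∈ D.bag a → v ∈ D.bag b → WalkIn T S (.inl a) (.inl b) := by
      intro a b ha hb
      refine (D.subtree v a b ha hb).induct (P := fun x => WalkIn T S (.inl a) (.inl x))
        (.refl ha) fun x y hx hy hxy hax => hax.trans (.of_adj ?_ hx hy)
      simp [hT, hxy]
    have hr : ∀ a b, v ∈ D'.bag a → v ∈ D'.bag b → WalkIn T S (.inr a) (.inr b) := by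
      intro a b ha hb
      refine (D'.subtree v a b ha hb).induct (P := fun x => WalkIn T S (.inr a) (.inr x))
        (.refl ha) fun x y hx hy hxy hax => hax.trans (.of_adj ?_ hx hy)
      simp [hT, hxy]
    have hlr : ∀ a b, v ∈ D.bag a → v ∈ D'.bag b → WalkIn T S (.inl a) (.inr b) := by
      intro a b ha hb
      -- A common vertex lies in both end bags of the new edge, so the edge joins its two subtrees.
      obtain ⟨h, h'⟩ := hsep v (D.bag_subset a v ha) (D'.bag_subset b v hb)
      refine (hl a s ha h).trans (.trans (.of_adj ?_ h h') (hr s' b h' hb))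
      simp [hT, SimpleGraph.edge_adj]
    rintro (a | a) (b | b) ha hb
    · exact hl a b ha hb
    · exact hlr a b ha hb
    · exact (hlr b a hb ha).symm
    · exact hr a b ha hb

end PartialDecomposition

/-! ### Brambles -/

section Bramble

variable {V : Type*} {G : SimpleGraph V} {k : ℕ} {𝓑 : Finset (Finset V)} {X : Finset V}

/-- Two sets of vertices touch if they meet or are joined by an edge. -/
def Touch (G : SimpleGraph V) (A B : Finset V) : Prop :=
  ∃ u ∈ A, ∃ v ∈ B, u = v ∨ G.Adj u v

/-- A bramble is a set of pairwise touching connected sets of vertices. -/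
structure IsBramble (G : SimpleGraph V) (𝓑 : Finset (Finset V)) : Prop where
  nonempty : ∀ B ∈ 𝓑, B.Nonempty
  connected : ∀ B ∈ 𝓑, ∀ u ∈ B, ∀ v ∈ B, WalkIn G B u v
  touch : ∀ B ∈ 𝓑, ∀ B' ∈ 𝓑, Touch G B B'

/-- `X` covers `𝓑` if it meets all members of `𝓑`. -/
def Covers (X : Finset V) (𝓑 : Finset (Finset V)) : Prop :=
  ∀ B ∈ 𝓑, ∃ x ∈ X, x ∈ B

/-- There is a tree decomposition of the subgraph induced by `A` which has `X` as a bag and in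
which no bag of more than `k` vertices covers `𝓑`. -/
def Admits (G : SimpleGraph V) (k : ℕ) (𝓑 : Finset (Finset V)) (A : Set V) (X : Finset V) : Prop :=
  ∃ (ι : Type) (_ : Fintype ι) (D : PartialDecomposition G A ι),
    (∃ s, D.bag s = X) ∧ ∀ t, k < (D.bag t).card → ¬ Covers (D.bag t) 𝓑

theorem Touch.symm {A B : Finset V} (h : Touch G A B) : Touch G B A := by
  obtain ⟨u, hu, v, hv, h⟩ := h
  exact ⟨v, hv, u, hu, h.imp Eq.symm fun h => h.symm⟩

theorem Admits.single (hX : X.card ≤ k) : Admits G k 𝓑 X X :=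
  ⟨Unit, inferInstance, .single G X, ⟨(), rfl⟩, fun _ ht => absurd hX (not_le.mpr ht)⟩

/-- Tree decompositions of overlapping subgraphs that have their common part as a bag. -/
theorem Admits.glue {A A' : Set V} (h : Admits G k 𝓑 A X) (h' : Admits G k 𝓑 A' X)
    (hsep : ∀ v ∈ A, v ∈ A' → v ∈ X) (hedge : ∀ u ∈ A, ∀ v ∈ A', G.Adj u v → u ∈ X ∨ v ∈ X) :
    Admits G k 𝓑 (A ∪ A') X := by
  obtain ⟨ι, _, D, ⟨s, hs⟩, hD⟩ := h
  obtain ⟨ι', _, D', ⟨s', hs'⟩, hD'⟩ := h'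
  refine ⟨ι ⊕ ι', inferInstance, D.glue D' s s'
    (fun v hv hv' => ⟨hs ▸ hsep v hv hv', hs' ▸ hsep v hv hv'⟩)
    (fun u hu v hv huv => (hedge u hu v hv huv).imp
      (fun h => D'.bag_subset s' u (hs' ▸ h)) fun h => D.bag_subset s v (hs ▸ h)),
    ⟨.inl s, hs⟩, ?_⟩
  rintro (t | t)
  exacts [hD t, hD' t]

/-- The two bags `X` and `C ∪ N(C)` form a tree decomposition. -/
theorem Admits.of_not_touch {C B : Finset V} (hXk : X.card ≤ k) (hB : B ∈ 𝓑) (hCB : ¬ Touch G C B) :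
    Admits G k 𝓑 (↑X ∪ ↑C) X := by
  classical
  let N := C ∪ X.filter fun x => ∃ c ∈ C, G.Adj c x
  have hN : ∀ v, v ∈ N ↔ v ∈ C ∨ v ∈ X ∧ ∃ c ∈ C, G.Adj c v := by simp [N]
  have hA : (↑X ∪ ↑C : Set V) = ↑X ∪ ↑N := by
    ext v
    simp only [Set.mem_union, Finset.mem_coe, hN]
    tauto
  rw [hA]
  refine ⟨Unit ⊕ Unit, inferInstance, (PartialDecomposition.single G X).glue (.single G N) () ()
    (fun v hv hv' => ⟨hv, hv'⟩) ?_, ⟨.inl (), rfl⟩, ?_⟩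
  · intro u hu v hv huv
    rcases (hN v).mp hv with h | h
    · exact .inl ((hN u).mpr (.inr ⟨hu, v, h, huv.symm⟩))
    · exact .inr h.1
  · rintro (t | t) ht hcov
    · exact absurd hXk (not_le.mpr ht)
    -- Each vertex of `N` is in `C` or adjacent to `C`, so one in `B` would make `C` touch `B`.
    · obtain ⟨x, hx, hxB⟩ := hcov B hB
      rcases (hN x).mp hx with h | ⟨-, c, hc, hcx⟩
      · exact hCB ⟨x, h, x, hxB, .inl rfl⟩
      · exact hCB ⟨c, hc, x, hxB, .inr hcx⟩

/-- A tree decomposition of `G` with a bag that covers `𝓑` is restricted to `X ∪ C`, where `X` is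
a cover of `𝓑` of minimum size and `C` is a union of components of `G - X`, and the vertices of
`X` are added to all bags on the way to the covering bag. -/
theorem Admits.of_treeDecomposition [DecidableEq V] {ι : Type} [Fintype ι]
    {C : Finset V} (h𝓑 : IsBramble G 𝓑) (hXk : X.card ≤ k) (hX : Covers X 𝓑)
    (hmin : ∀ Y, Covers Y 𝓑 → X.card ≤ Y.card)
    (hC : ∀ u ∈ C, ∀ v, G.Adj u v → v ∈ X ∨ v ∈ C) (D : TreeDecomposition G ι)
    (hD : ∀ t, k < (D.bag t).card → ¬ Covers (D.bag t) (insert C 𝓑)) {s : ι}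
    (hs : Covers (D.bag s) 𝓑) (hsC : ∀ v ∈ D.bag s, v ∉ C) :
    Admits G k 𝓑 (↑X ∪ ↑C) X := by
  classical
  choose a ha using D.vertex_mem
  choose p hp using fun v => (D.isTree.existsUnique_path (a v) s).exists
  let W : ι → Finset V := fun t =>
    D.bag t ∩ (X ∪ C) ∪ X.filter fun x => t ∈ (p x).support ∧ x ∉ D.bag t
  have hW : ∀ v t, v ∈ W t ↔ v ∈ D.bag t ∧ (v ∈ X ∨ v ∈ C) ∨
      v ∈ X ∧ t ∈ (p v).support ∧ v ∉ D.bag t := by simp [W]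
  -- No bag grows: the set `Z` of added vertices is at most as large as the discarded part of the
  -- bag. Exchanging `Z` for that part in `X` gives another cover, which cannot be smaller than `X`.
  have hcard : ∀ t, (W t).card ≤ (D.bag t).card := by
    intro t
    set Z := X.filter fun x => t ∈ (p x).support ∧ x ∉ D.bag t with hZ
    have hZm : ∀ v, v ∈ Z ↔ v ∈ X ∧ t ∈ (p v).support ∧ v ∉ D.bag t := by simp [hZ]
    have hcov : Covers (X \ Z ∪ D.bag t \ (X ∪ C)) 𝓑 := by
      intro B hB
      by_contra! hQ
      have hQ1 : ∀ x ∈ X, x ∈ B → x ∈ Z := fun x hx hxB => by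
        by_contra hxZ
        exact hQ x (by simp [hx, hxZ]) hxB
      have hQ2 : ∀ x ∈ D.bag t, x ∈ B → x ∈ X ∨ x ∈ C := fun x hx hxB => by
        by_contra! hxX
        exact hQ x (by simp [hx, hxX]) hxB
      obtain ⟨x, hxX, hxB⟩ := hX B hB
      obtain ⟨y, hys, hyB⟩ := hs B hB
      have hyC := hsC y hys
      have hyX : y ∉ X := by
        intro hyX
        obtain ⟨-, hyt, hyn⟩ := (hZm y).mp (hQ1 y hyX hyB)
        obtain ⟨z, rfl, hz⟩ := D.exists_mem_bag (hp y) hyt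
          (WalkIn.refl (G := G) (S := {y}) rfl) (ha y) hys
        exact hyn hz
      -- The walk in `B` leaves `X ∪ C` for the last time at `x₁`, which is in `X` because no edge
      -- leads from `C` out of `X ∪ C`. As `t` is on the path from `a x₁` to `s`, the rest of the
      -- walk, with `x₁`, meets the bag of `t`. Both `x₁ ∈ Z` and `hQ2` rule this out.
      obtain ⟨x₁, y₁, hx₁, hx₁B, hadj, hw⟩ :=
        (h𝓑.connected B hB x hxB y hyB).exists_exit (S := {v | v ∈ X ∨ v ∈ C})
          (.inl hxX) (not_or.mpr ⟨hyX, hyC⟩)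
      have hx₁X : x₁ ∈ X := hx₁.resolve_right fun h => hw.left_mem.2 (hC x₁ h y₁ hadj)
      obtain ⟨-, hx₁t, hx₁n⟩ := (hZm x₁).mp (hQ1 x₁ hx₁X hx₁B)
      have hw' : WalkIn G (insert x₁ ((B : Set V) \ {v | v ∈ X ∨ v ∈ C})) x₁ y :=
        (WalkIn.of_adj hadj (.inl rfl) (.inr hw.left_mem)).trans (hw.mono fun _ h => .inr h)
      obtain ⟨z, rfl | hz, hzt⟩ := D.exists_mem_bag (hp x₁) hx₁t hw' (ha x₁) hys
      · exact hx₁n hzt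
      · exact hz.2 (hQ2 z hzt hz.1)
    have h1 := (hmin _ hcov).trans (Finset.card_union_le _ _)
    have h5 : (X \ Z).card = X.card - Z.card :=
      Finset.card_sdiff_of_subset (Finset.filter_subset _ _)
    have h2 : Z.card ≤ X.card := Finset.card_le_card (Finset.filter_subset _ _)
    have h3 := Finset.card_inter_add_card_sdiff (D.bag t) (X ∪ C)
    have h4 : (W t).card ≤ (D.bag t ∩ (X ∪ C)).card + Z.card := Finset.card_union_le _ _
    omega
  have hsub : ∀ v t, v ∈ D.bag t → (v ∈ X ∨ v ∈ C) → v ∈ W t :=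
    fun v t hv h => (hW v t).mpr (.inl ⟨hv, h⟩)
  refine ⟨ι, inferInstance,
    { tree := D.tree
      isTree := D.isTree
      bag := W
      bag_subset := ?_
      vertex_mem := fun v hv => ⟨a v, hsub v _ (ha v) hv⟩
      edge_mem := fun u hu v hv huv => (D.edge_mem u v huv).imp fun t ht =>
        ⟨hsub u t ht.1 hu, hsub v t ht.2 hv⟩
      subtree := ?_ }, ⟨s, ?_⟩, ?_⟩
  · intro t v hv
    rcases (hW v t).mp hv with h | h
    exacts [h.2, .inl h.1]
  · intro v b c hb hc
    by_cases hv : v ∈ X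
    · have key : ∀ c, v ∈ W c → WalkIn D.tree {t | v ∈ W t} (a v) c := by
        intro c hc
        rcases (hW v c).mp hc with h | h
        · exact (D.walkIn (ha v) h.1).mono fun t ht => hsub v t ht (.inl hv)
        · refine (WalkIn.of_support (p v) h.2.1).mono fun t ht => ?_
          by_cases hvt : v ∈ D.bag t
          · exact hsub v t hvt (.inl hv)
          · exact (hW v t).mpr (.inr ⟨hv, ht, hvt⟩)
      exact (key b hb).symm.trans (key c hc)
    · have key : ∀ c, v ∈ W c → v ∈ D.bag c ∧ (v ∈ X ∨ v ∈ C) := fun c hc =>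
        ((hW v c).mp hc).resolve_right fun h => hv h.1
      exact (D.walkIn (key b hb).1 (key c hc).1).mono fun t ht => hsub v t ht (key b hb).2
  · ext v
    refine (hW v s).trans ⟨?_, fun hv => ?_⟩
    · rintro (⟨h, h' | h'⟩ | h)
      exacts [h', absurd h' (hsC v h), h.1]
    · by_cases hvs : v ∈ D.bag s
      exacts [.inl ⟨hvs, .inl hv⟩, .inr ⟨hv, (p v).end_mem_support, hvs⟩]
  · intro t ht hcov
    -- A bag larger than `X` contains a vertex of `C`, so the original bag covers the new member `C`
    -- as well. If a member of `𝓑` is met only in an added vertex, its connectedness up to the bag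
    -- of `s` makes it meet the original bag too.
    obtain ⟨c, hcW, hcX⟩ := Finset.exists_mem_notMem_of_card_lt_card (hXk.trans_lt ht)
    have hc := ((hW c t).mp hcW).resolve_right fun h => hcX h.1
    refine hD t (ht.trans_le (hcard t)) fun B hB => ?_
    rcases Finset.mem_insert.mp hB with rfl | hB
    · exact ⟨c, hc.1, hc.2.resolve_left hcX⟩
    · obtain ⟨x, hxW, hxB⟩ := hcov B hB
      rcases (hW x t).mp hxW with h | h
      · exact ⟨x, h.1, hxB⟩
      · obtain ⟨y, hys, hyB⟩ := hs B hB
        obtain ⟨z, hzB, hzt⟩ := D.exists_mem_bag (hp x) h.2.1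
          (h𝓑.connected B hB x hxB y hyB) (ha x) hys
        exact ⟨z, hzt, hzB⟩

/-- If tree decompositions exist for all components of `G - X`, then they can be put together. -/
theorem Admits.of_components [DecidableEq V] (hXk : X.card ≤ k)
    (h : ∀ v ∉ X, Admits G k 𝓑 (X ∪ {u | WalkIn G {x | x ∉ X} v u}) X) (S : Finset V)
    (hS : ∀ v ∈ S, v ∉ X) :
    Admits G k 𝓑 (X ∪ {u | ∃ v ∈ S, WalkIn G {x | x ∉ X} v u}) X := by
  induction S using Finset.induction_on with
  | empty => simpa using Admits.single hXk
  | insert v S hv ih =>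
    have ih := ih fun u hu => hS u (Finset.mem_insert_of_mem hu)
    -- A representative of a component already treated contributes nothing new.
    by_cases hvS : ∃ w ∈ S, WalkIn G {x | x ∉ X} w v
    · convert ih using 2
      ext u
      simp only [Set.mem_ofPred_eq]
      obtain ⟨w, hw, hwv⟩ := hvS
      constructor
      · rintro ⟨x, hx, hxu⟩
        rcases Finset.mem_insert.mp hx with rfl | hx
        exacts [⟨w, hw, hwv.trans hxu⟩, ⟨x, hx, hxu⟩]
      · rintro ⟨x, hx, hxu⟩
        exact ⟨x, Finset.mem_insert_of_mem hx, hxu⟩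
    · have hg := ih.glue (h v (hS v (Finset.mem_insert_self v S))) ?_ ?_
      · convert hg using 1
        ext u
        simp only [Finset.mem_insert, Set.mem_union, Set.mem_ofPred_eq, exists_eq_or_imp]
        grind
      · rintro u (hu | ⟨w, hw, hwu⟩) (hu' | hu')
        · exact hu
        · exact hu
        · exact hu'
        · exact absurd ⟨w, hw, hwu.trans hu'.symm⟩ hvS
      · rintro u (hu | ⟨w, hw, hwu⟩) u' (hu' | hu') huu'
        · exact .inl hu
        · exact .inl hu
        · exact .inr hu'
        · exact absurd ⟨w, hw, hwu.trans ((WalkIn.of_adj huu' hwu.right_mem hu'.right_mem).trans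
            hu'.symm)⟩ hvS

/-- If every bramble is covered by `k` vertices, then for every bramble there is a tree
decomposition in which no bag of more than `k` vertices covers it. -/
theorem IsBramble.exists_treeDecomposition [Fintype V]
    (hcov : ∀ 𝓑, IsBramble G 𝓑 → ∃ X : Finset V, X.card ≤ k ∧ Covers X 𝓑)
    (𝓑 : Finset (Finset V)) (h𝓑 : IsBramble G 𝓑) :
    ∃ (ι : Type) (_ : Fintype ι) (D : TreeDecomposition G ι),
      ∀ t, k < (D.bag t).card → ¬ Covers (D.bag t) 𝓑 := by
  classical
  -- Larger brambles come first; there are only finitely many sets of vertex sets.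
  induction 𝓑 using WellFoundedGT.induction with
  | ind 𝓑 ih =>
  obtain ⟨X, hX, hmin⟩ := Finset.exists_min_image (Finset.univ.filter fun X => Covers X 𝓑)
    Finset.card ⟨_, Finset.mem_filter.mpr ⟨Finset.mem_univ _, (hcov 𝓑 h𝓑).choose_spec.2⟩⟩
  replace hX : Covers X 𝓑 := (Finset.mem_filter.mp hX).2
  replace hmin : ∀ Y, Covers Y 𝓑 → X.card ≤ Y.card := fun Y hY => hmin Y (by simpa using hY)
  have hXk : X.card ≤ k := (hcov 𝓑 h𝓑).elim fun Y hY => (hmin Y hY.2).trans hY.1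
  by_contra hno
  have hcomp : ∀ v ∉ X, Admits G k 𝓑 (X ∪ {u | WalkIn G {x | x ∉ X} v u}) X := by
    intro v hv
    let C : Finset V := Finset.univ.filter fun u => WalkIn G {x | x ∉ X} v u
    have hCm : ∀ u, u ∈ C ↔ WalkIn G {x | x ∉ X} v u := by simp [C]
    have hCX : ∀ u ∈ C, u ∉ X := fun u hu => ((hCm u).mp hu).right_mem
    have hC : ∀ u ∈ C, ∀ w, G.Adj u w → w ∈ X ∨ w ∈ C := by
      intro u hu w huw
      by_cases hw : w ∈ X
      · exact .inl hw
      · exact .inr ((hCm w).mpr (((hCm u).mp hu).trans (.of_adj huw (hCX u hu) hw)))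
    have hA : (X ∪ {u | WalkIn G {x | x ∉ X} v u} : Set V) = ↑X ∪ ↑C := by
      ext u
      simp [hCm]
    rw [hA]
    by_cases htouch : ∀ B ∈ 𝓑, Touch G C B
    · have hvC : v ∈ C := (hCm v).mpr (.refl hv)
      have hconn : ∀ u ∈ C, WalkIn G C v u := fun u hu =>
        (((hCm u).mp hu).induct (P := fun w => WalkIn G {x | x ∉ X} v w ∧ WalkIn G C v w)
          ⟨.refl hv, .refl hvC⟩ fun x y hx hy hxy h => by
            have hy' := h.1.trans (.of_adj hxy hx hy)
            exact ⟨hy', h.2.trans (.of_adj hxy h.2.right_mem ((hCm y).mpr hy'))⟩).2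
      -- `X` meets all members of `𝓑` but not `C`, so the bramble strictly grows.
      have hC𝓑 : C ∉ 𝓑 := fun h => (hX C h).elim fun x hx => hCX x hx.2 hx.1
      have h𝓑' : IsBramble G (insert C 𝓑) := by
        refine ⟨?_, ?_, ?_⟩
        · simpa using ⟨⟨v, hvC⟩, h𝓑.nonempty⟩
        · intro B hB
          rcases Finset.mem_insert.mp hB with rfl | hB
          · exact fun u hu w hw => (hconn u hu).symm.trans (hconn w hw)
          · exact h𝓑.connected B hB
        · intro B hB B' hB'
          rcases Finset.mem_insert.mp hB with rfl | hB <;>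
            rcases Finset.mem_insert.mp hB' with rfl | hB'
          · exact ⟨v, hvC, v, hvC, .inl rfl⟩
          · exact htouch B' hB'
          · exact (htouch B hB).symm
          · exact h𝓑.touch B hB B' hB'
      obtain ⟨ι, _, D, hD⟩ := ih _ (Finset.ssubset_insert hC𝓑) h𝓑'
      have : ∃ s, k < (D.bag s).card ∧ Covers (D.bag s) 𝓑 := by
        by_contra! h
        exact hno ⟨ι, inferInstance, D, h⟩
      obtain ⟨s, hsk, hs⟩ := this
      -- The large bag of `s` covers `𝓑`; if it met `C`, it would cover the enlarged bramble.
      refine .of_treeDecomposition h𝓑 hXk hX hmin hC D hD hs fun u hu huC => hD s hsk ?_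
      intro B hB
      rcases Finset.mem_insert.mp hB with rfl | hB
      exacts [⟨u, hu, huC⟩, hs B hB]
    · push Not at htouch
      obtain ⟨B, hB, hCB⟩ := htouch
      exact .of_not_touch hXk hB hCB
  obtain ⟨ι, _, D, -, hD⟩ := Admits.of_components hXk hcomp (Finset.univ \ X) (by simp)
  refine hno ⟨ι, inferInstance, D.toTreeDecomposition fun v => ?_, hD⟩
  by_cases hv : v ∈ X
  · exact .inl hv
  · exact .inr ⟨v, by simpa using hv, .refl hv⟩

end Bramble

/-- The width of a tree decomposition bounds the treewidth. -/
theorem treewidth_add_one_le {V : Type*} {G : SimpleGraph V} {ι : Type} [Fintype ι]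
    (D : TreeDecomposition G ι) {k : ℕ} (hk : 0 < k) (hD : ∀ t, (D.bag t).card ≤ k) :
    treewidth G + 1 ≤ k := by
  have h1 : treewidth G ≤ D.width := Nat.sInf_le ⟨ι, inferInstance, D, rfl⟩
  have h2 : (Finset.univ.sup fun t => (D.bag t).card) ≤ k := Finset.sup_le fun t _ => hD t
  have h3 : D.width ≤ k - 1 := Nat.sub_le_sub_right h2 1
  omega

/-- A graph of treewidth at least `k` has a bramble which is not covered by `k` vertices. -/
theorem exists_bramble {V : Type*} [Fintype V] (G : SimpleGraph V) {k : ℕ} (hk : 0 < k)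
    (h : k < treewidth G + 1) :
    ∃ 𝓑, IsBramble G 𝓑 ∧ ∀ X : Finset V, X.card ≤ k → ¬ Covers X 𝓑 := by
  classical
  by_contra! hcov
  -- Every set covers the empty bramble, so here all bags have at most `k` vertices.
  obtain ⟨ι, _, D, hD⟩ := IsBramble.exists_treeDecomposition hcov ∅ ⟨by simp, by simp, by simp⟩
  refine absurd (treewidth_add_one_le D hk fun t => ?_) (not_le.mpr h)
  by_contra! ht
  exact hD t ht fun B hB => absurd hB (Finset.notMem_empty B)

/-- The treewidth is attained. -/
theorem exists_treeDecomposition {V : Type*} [Fintype V] (G : SimpleGraph V) :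
    ∃ (ι : Type) (_ : Fintype ι) (D : TreeDecomposition G ι),
      ∀ t, (D.bag t).card ≤ treewidth G + 1 := by
  obtain ⟨ι, _, D, hD⟩ := Nat.sInf_mem
    (s := {w | ∃ (ι : Type) (_ : Fintype ι) (D : TreeDecomposition G ι), D.width = w})
    ⟨_, Unit, inferInstance, (PartialDecomposition.single G Finset.univ).toTreeDecomposition
      fun v => Finset.mem_univ v, rfl⟩
  refine ⟨ι, inferInstance, D, fun t => ?_⟩
  have h : (D.bag t).card ≤ Finset.univ.sup fun t => (D.bag t).card :=
    Finset.le_sup (f := fun t => (D.bag t).card) (Finset.mem_univ t)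
  change D.width = treewidth G at hD
  rw [← hD, TreeDecomposition.width]
  omega

/-! ### Positional play -/

section Game

variable {V : Type*} {G : SimpleGraph V} {k : ℕ}

/-- Each cop stays where it is or moves to an adjacent vertex. -/
def CopMove (G : SimpleGraph V) (C C' : Fin k → V) : Prop :=
  ∀ i, C' i = C i ∨ G.Adj (C i) (C' i)

/-- With the cops at `C`, the robber at `v` and the cops to move, the cops can win within `n`
turns. -/
def WinsIn (G : SimpleGraph V) : ℕ → (Fin k → V) → V → Prop
  | 0, _, _ => False
  | n + 1, C, v => ∃ C', CopMove G C C' ∧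
      ((∃ i, C' i = v) ∨ ∀ v', RobberMove G C' v v' → WinsIn G n C' v')

/-- With the cops at `C`, the robber at `v` and the cops to move, the cops can win. -/
def Wins (G : SimpleGraph V) (C : Fin k → V) (v : V) : Prop := ∃ n, WinsIn G n C v

theorem WinsIn.mono {m n : ℕ} (hmn : m ≤ n) {C : Fin k → V} {v : V} (h : WinsIn G m C v) :
    WinsIn G n C v := by
  induction m generalizing n C v with
  | zero => exact h.elim
  | succ m ih =>
    obtain ⟨n, rfl⟩ := Nat.exists_eq_add_of_le' (Nat.one_le_of_lt hmn)
    obtain ⟨C', hC', h⟩ := h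
    exact ⟨C', hC', h.imp_right fun h v' hv' => ih (Nat.le_of_succ_le_succ hmn) (h v' hv')⟩

/-- Finiteness of `V` gives one bound on the number of turns for all answers of the robber. -/
theorem Wins.of_copMove [Finite V] {C C' : Fin k → V} {v : V} (hC : CopMove G C C')
    (h : ∀ v', RobberMove G C' v v' → Wins G C' v') : Wins G C v := by
  have : ∀ v', ∃ n, RobberMove G C' v v' → WinsIn G n C' v' := fun v' => by
    by_cases hv' : RobberMove G C' v v'
    · exact (h v' hv').imp fun n hn _ => hn
    · exact ⟨0, fun h => absurd h hv'⟩
  choose f hf using this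
  obtain ⟨N, hN⟩ := (Set.finite_range f).bddAbove
  exact ⟨N + 1, C', hC, .inr fun v' hv' => (hf v' hv').mono (hN ⟨v', rfl⟩)⟩

theorem Wins.of_mem {C : Fin k → V} {v : V} (h : ∃ i, C i = v) : Wins G C v :=
  ⟨1, C, fun _ => .inl rfl, .inl h⟩

/-- Cops that can win against every start of the robber have a winning strategy. -/
theorem exists_isWinning (C₀ : Fin k → V) (h : ∀ v, Wins G C₀ v) :
    ∃ σ : CopStrategy G k, σ.IsWinning := by
  classical
  -- A move chosen for the least possible number of turns works for every bound `n` at once, so the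
  -- strategy can be positional and the bound drops in each turn.
  have hnext : ∀ (C : Fin k → V) (v : V), ∃ C', CopMove G C C' ∧ ∀ n, WinsIn G n C v →
      (∃ i, C' i = v) ∨ ∀ v', RobberMove G C' v v' → ∃ m < n, WinsIn G m C' v' := by
    intro C v
    by_cases hw : ∃ n, WinsIn G n C v
    · obtain ⟨n, hn, hmin⟩ : ∃ n, WinsIn G n C v ∧ ∀ m, WinsIn G m C v → n ≤ m :=
        ⟨Nat.find hw, Nat.find_spec hw, fun m hm => Nat.find_min' hw hm⟩
      cases n with
      | zero => exact hn.elim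
      | succ n =>
        obtain ⟨C', hC', hn⟩ := hn
        exact ⟨C', hC', fun m hm => hn.imp_right fun hn v' hv' => ⟨n, hmin m hm, hn v' hv'⟩⟩
    · exact ⟨C, fun _ => .inl rfl, fun n hn => absurd ⟨n, hn⟩ hw⟩
  choose next hlegal hnext using hnext
  let σ : CopStrategy G k :=
    { pos := fun l => l.foldr (fun v C => next C v) C₀
      legal := fun l v i => hlegal _ v i }
  refine ⟨σ, fun r hr => ?_⟩
  have key : ∀ n m, WinsIn G n (σ.pos (history r m)) (r m) → ∃ j, σ.Captures r j := by
    intro n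
    induction n using Nat.strong_induction_on with
    | _ n ih =>
      intro m hm
      by_cases hcap : σ.Captures r m
      · exact ⟨m, hcap⟩
      · obtain ⟨l, hl, hw⟩ := ((hnext _ _ n hm).resolve_left hcap) _ (hr m hcap)
        exact ih l hl (m + 1) hw
  obtain ⟨n, hn⟩ := h (r 0)
  exact key n 0 hn

/-- If the robber can always move from a safe vertex to a safe vertex, then she escapes. -/
theorem CopStrategy.not_isWinning (σ : CopStrategy G k) (Safe : (Fin k → V) → V → Prop)
    (hstart : ∀ C, ∃ v, Safe C v)
    (hmove : ∀ C C' v, Safe C v → CopMove G C C' →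
      (∀ i, C' i ≠ v) ∧ ∃ v', RobberMove G C' v v' ∧ Safe C' v') : ¬ σ.IsWinning := by
  intro hσ
  have hf : ∀ (h : List V) (v : V), ∃ v', Safe (σ.pos h) v → (∀ i, σ.pos (v :: h) i ≠ v) ∧
      RobberMove G (σ.pos (v :: h)) v v' ∧ Safe (σ.pos (v :: h)) v' := by
    intro h v
    by_cases hs : Safe (σ.pos h) v
    · obtain ⟨h1, v', h2⟩ := hmove _ _ v hs (σ.legal h v)
      exact ⟨v', fun _ => ⟨h1, h2⟩⟩
    · exact ⟨v, fun h => absurd h hs⟩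
  choose f hf using hf
  obtain ⟨v₀, hv₀⟩ := hstart (σ.pos [])
  let st : ℕ → List V × V := fun n => n.rec ([], v₀) fun _ q => (q.2 :: q.1, f q.1 q.2)
  let r : ℕ → V := fun n => (st n).2
  have hst : ∀ n, (st n).1 = history r n := by
    intro n
    induction n with
    | zero => rfl
    | succ n ih => exact congrArg (r n :: ·) ih
  have hr : ∀ n, r (n + 1) = f (history r n) (r n) := fun n => by
    rw [← hst]
  have hsafe : ∀ n, Safe (σ.pos (history r n)) (r n) := by
    intro n
    induction n with
    | zero => exact hv₀
    | succ n ih =>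
      rw [hr]
      exact (hf _ _ ih).2.2
  obtain ⟨n, i, hi⟩ := hσ r fun n _ => by
    rw [hr]
    exact (hf _ _ (hsafe n)).2.1
  exact (hf _ _ (hsafe n)).1 i hi

theorem RobberMove.of_walkIn {C : Fin k → V} {S : Set V} {u v : V} (h : WalkIn G S u v)
    (hC : ∀ i, C i ∉ S) : RobberMove G C u v :=
  h.elim fun p hp => ⟨p, fun x hx i hi => hC i (hi ▸ hp x hx)⟩

theorem copNumber_le (C₀ : Fin k → V) (h : ∀ v, Wins G C₀ v) : copNumber G ≤ k :=
  Nat.sInf_le (exists_isWinning C₀ h)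

theorem CopStrategy.IsWinning.pos [Nonempty V] {σ : CopStrategy G k} (hσ : σ.IsWinning) :
    0 < k := by
  rw [Nat.pos_iff_ne_zero]
  rintro rfl
  refine σ.not_isWinning (fun _ _ => True) (fun _ => ⟨Classical.arbitrary V, trivial⟩)
    (fun C C' v _ _ => ⟨fun i => i.elim0, v, ⟨.nil, fun _ _ i => i.elim0⟩, trivial⟩) hσ

/-- The robber escapes from fewer than `(tw + 1) / (Δ + 1)` cops by staying in a member of a
bramble that the cops cannot reach in one turn. -/
theorem CopStrategy.IsWinning.treewidth_add_one_le [Fintype V] [Nonempty V]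
    [DecidableRel G.Adj] {σ : CopStrategy G k} (hσ : σ.IsWinning) :
    treewidth G + 1 ≤ k * (G.maxDegree + 1) := by
  classical
  by_contra! hlt
  obtain ⟨𝓑, h𝓑, hcov⟩ := exists_bramble G (Nat.mul_pos hσ.pos (Nat.succ_pos _)) hlt
  let N : (Fin k → V) → Finset V := fun C =>
    Finset.univ.biUnion fun i => insert (C i) (G.neighborFinset (C i))
  have hN : ∀ C C' : Fin k → V, CopMove G C C' → ∀ i, C' i ∈ N C := by
    intro C C' h i
    simp only [N, Finset.mem_biUnion, Finset.mem_univ, true_and, Finset.mem_insert,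
      SimpleGraph.mem_neighborFinset]
    exact ⟨i, h i⟩
  have hNcard : ∀ C, (N C).card ≤ k * (G.maxDegree + 1) := by
    intro C
    refine (Finset.card_biUnion_le_card_mul _ _ (G.maxDegree + 1) fun i _ => ?_).trans (by simp)
    refine (Finset.card_insert_le _ _).trans (Nat.succ_le_succ ?_)
    rw [SimpleGraph.card_neighborFinset_eq_degree]
    exact G.degree_le_maxDegree _
  have hfree : ∀ C : Fin k → V, ∃ B ∈ 𝓑, ∀ x ∈ N C, x ∉ B := fun C => by
    simpa [Covers] using hcov (N C) (hNcard C)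
  refine σ.not_isWinning (fun C v => ∃ B ∈ 𝓑, v ∈ B ∧ ∀ x ∈ N C, x ∉ B) ?_ ?_ hσ
  · intro C
    obtain ⟨B, hB, hCB⟩ := hfree C
    obtain ⟨v, hv⟩ := h𝓑.nonempty B hB
    exact ⟨v, B, hB, hv, hCB⟩
  · rintro C C' v ⟨B, hB, hv, hCB⟩ hCC'
    have hC'B : ∀ i, C' i ∉ B := fun i => hCB _ (hN C C' hCC' i)
    refine ⟨fun i hi => hC'B i (hi ▸ hv), ?_⟩
    obtain ⟨B', hB', hCB'⟩ := hfree C'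
    -- Staying put is a legal move, so the cops themselves lie in `N C'`.
    have hC'B' : ∀ i, C' i ∉ B' := fun i => hCB' _ (hN C' C' (fun _ => .inl rfl) i)
    obtain ⟨u, hu, w, hw, huw⟩ := h𝓑.touch B hB B' hB'
    have h1 : WalkIn G (B ∪ B' : Set V) v u :=
      (h𝓑.connected B hB v hv u hu).mono Set.subset_union_left
    have h2 : WalkIn G (B ∪ B' : Set V) u w := by
      rcases huw with rfl | huw
      · exact .refl (.inl hu)
      · exact .of_adj huw (.inl hu) (.inr hw)
    exact ⟨w, .of_walkIn (h1.trans h2) fun i hi => hi.elim (hC'B i) (hC'B' i), B', hB', hw, hCB'⟩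

end Game

/-! ### Searching along a tree decomposition -/

section Search

variable {V ι : Type*} {G : SimpleGraph V}

/-- The nodes that can be reached from the bags containing `v` without meeting `t`. -/
def TreeDecomposition.side (D : TreeDecomposition G ι) (t : ι) (v : V) : Set ι :=
  {a | ∃ b, v ∈ D.bag b ∧ WalkIn D.tree {c | c ≠ t} a b}

/-- If `v` is not in the bag of `t`, then there is a next node `s` in the direction of `v` such
that a walk starting at `v` that does not meet both bags at once can only lead to vertices for
which less than before remains beyond `s`. -/
theorem TreeDecomposition.exists_side_ssubset (D : TreeDecomposition G ι) {t : ι} {v : V}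
    (hv : v ∉ D.bag t) :
    ∃ s, ∀ v', WalkIn G {x | ¬ (x ∈ D.bag t ∧ x ∈ D.bag s)} v v' → v' ∉ D.bag s →
      D.side s v' ⊂ D.side t v := by
  have hT := D.isTree.isAcyclic
  obtain ⟨b₀, hb₀⟩ := D.vertex_mem v
  obtain ⟨p, hp⟩ := (D.isTree.existsUnique_path t b₀).exists
  -- The next node `s` is the second node on the path from `t` to a bag containing `v`.
  cases p with
  | nil => exact absurd hb₀ hv
  | @cons _ s _ hts q =>
  have hsb : WalkIn D.tree {c | c ≠ t} s b₀ := by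
    refine ⟨q, fun x hx => ?_⟩
    rintro rfl
    exact ((SimpleGraph.Walk.cons_isPath_iff _ _).mp hp).2 hx
  refine ⟨s, fun v' hvv' hv's => ?_⟩
  have hinv : ∀ b, v' ∈ D.bag b → WalkIn D.tree {c | c ≠ t} b s := by
    have hsub : ∀ x, x ∉ D.bag t → ∀ c d, x ∈ D.bag c → x ∈ D.bag d →
        WalkIn D.tree {c | c ≠ t} c d := fun x hx c d hc hd =>
      (D.walkIn hc hd).mono fun e he => by
        rintro rfl
        exact hx he
    refine hvv'.induct (P := fun x => ∀ b, x ∈ D.bag b → WalkIn D.tree {c | c ≠ t} b s)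
      (fun b hb => (hsub v hv b b₀ hb hb₀).trans hsb.symm) ?_
    intro x y _ hy hxy hx b hb
    obtain ⟨d, hxd, hyd⟩ := D.edge_mem x y hxy
    have hds := hx d hxd
    -- If the bag of `t` contained `y`, the subtree of `y` would run from beyond `s` to `t` and
    -- hence through `s`, putting `y` into both bags.
    by_cases hyt : y ∈ D.bag t
    · refine absurd ((D.walkIn hyd hyt).mono fun e he => ?_) (not_walkIn_of_walkIn hT hts hds)
      rintro rfl
      exact hy ⟨hyt, he⟩
    · exact (hsub y hyt b d hb hyd).trans hds
  -- The node `s` itself makes the inclusion strict.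
  have hs : s ∈ D.side t v := ⟨b₀, hb₀, hsb⟩
  have hs' : s ∉ D.side s v' := fun ⟨b, _, hb⟩ => hb.left_mem rfl
  refine ⟨fun a ⟨b, hb, hab⟩ => ?_, fun h => hs' (h hs)⟩
  have hbs := hinv b hb
  refine ⟨b₀, hb₀, .trans (v := b) ?_ (hbs.trans hsb)⟩
  -- A walk from beyond `s` that avoids `s` can never reach `t`.
  have key : WalkIn D.tree {c | c ≠ t} b a ∧ WalkIn D.tree {c | c ≠ s} b a := by
    refine hab.symm.induct
      (P := fun c => WalkIn D.tree {c | c ≠ t} b c ∧ WalkIn D.tree {c | c ≠ s} b c)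
      ⟨.refl hbs.left_mem, .refl hab.right_mem⟩ fun x y hx hy hxy h => ?_
    have h' := h.2.trans (.of_adj hxy hx hy)
    refine ⟨h.1.trans (.of_adj hxy h.1.right_mem ?_), h'⟩
    rintro rfl
    exact not_walkIn_of_walkIn hT hts hbs h'
  exact key.1.symm

/-- The cops can be assigned to the vertices of `B` in such a way that those of `A ∩ B` are
assigned to cops that already stand there. -/
theorem exists_assignment {k : ℕ} [DecidableEq V] (C : Fin k → V) (A B : Finset V)
    (hA : ∀ x ∈ A, ∃ i, C i = x) (hB : B.card ≤ k) :
    ∃ C' : Fin k → V, (∀ x ∈ B, ∃ i, C' i = x) ∧ ∀ x ∈ A, x ∈ B → ∃ i, C i = x ∧ C' i = x := by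
  choose f hf using hA
  let I : Finset (Fin k) := (A ∩ B).attach.image fun x : {x // x ∈ A ∩ B} =>
    f x.1 (Finset.mem_inter.mp x.2).1
  have hI : I.card ≤ (A ∩ B).card := Finset.card_image_le.trans_eq Finset.card_attach
  -- At most `|A ∩ B|` cops are needed as guards, and enough others remain for the rest of `B`.
  have hcard : (B \ A).card ≤ Iᶜ.card := by
    have h1 := Finset.card_inter_add_card_sdiff B A
    rw [Finset.inter_comm] at h1
    rw [Finset.card_compl, Fintype.card_fin]
    omega
  obtain ⟨T, hT, hTcard⟩ := Finset.exists_subset_card_eq hcard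
  let e : T ≃ (B \ A : Finset V) := Finset.equivOfCardEq hTcard
  have hAB : ∀ x ∈ A, x ∈ B → ∃ i, C i = x ∧
      (if h : i ∈ T then (e ⟨i, h⟩ : V) else C i) = x := by
    intro x hxA hxB
    have hI : f x hxA ∈ I := Finset.mem_image.mpr
      ⟨⟨x, Finset.mem_inter.mpr ⟨hxA, hxB⟩⟩, Finset.mem_attach _ _, rfl⟩
    have : f x hxA ∉ T := fun h => Finset.mem_compl.mp (hT h) hI
    exact ⟨f x hxA, hf x hxA, by rw [dif_neg this, hf]⟩
  refine ⟨fun i => if h : i ∈ T then (e ⟨i, h⟩ : V) else C i, fun x hx => ?_, hAB⟩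
  by_cases hxA : x ∈ A
  · exact (hAB x hxA hx).imp fun i hi => hi.2
  · refine ⟨(e.symm ⟨x, Finset.mem_sdiff.mpr ⟨hx, hxA⟩⟩ : T), ?_⟩
    simp

/-- One step along a shortest walk. The last clause holds cops that have arrived in place, so guards
never leave their posts. -/
theorem exists_dist_le (hG : G.Connected) {u w : V} {n : ℕ} (h : G.dist u w ≤ n + 1) :
    ∃ u', (u' = u ∨ G.Adj u u') ∧ G.dist u' w ≤ n ∧ (u = w → u' = w) := by
  obtain ⟨p, hp⟩ := hG.exists_walk_length_eq_dist u w
  cases p with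
  | nil => exact ⟨u, .inl rfl, by simp, id⟩
  | @cons _ u' _ hadj q =>
    refine ⟨u', .inr hadj, ?_, ?_⟩
    · have := SimpleGraph.dist_le q
      rw [SimpleGraph.Walk.length_cons] at hp
      omega
    · rintro rfl
      simp at hp

/-- If the cops occupy a bag of a tree decomposition with bags of at most `k` vertices, then they
can win. -/
theorem TreeDecomposition.wins [Finite V] [Finite ι] (D : TreeDecomposition G ι)
    (hG : G.Connected) {k : ℕ} (hk : ∀ t, (D.bag t).card ≤ k) (n : ℕ) (t : ι) (v : V)
    (C : Fin k → V) (hn : (D.side t v).ncard = n) (hC : ∀ x ∈ D.bag t, ∃ i, C i = x) :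
    Wins G C v := by
  classical
  induction n using Nat.strong_induction_on generalizing t v C with
  | _ n ih =>
  by_cases hv : v ∈ D.bag t
  · exact .of_mem (hC v hv)
  obtain ⟨s, hs⟩ := D.exists_side_ssubset hv
  obtain ⟨C', hC', hCC'⟩ := exists_assignment C (D.bag t) (D.bag s) hC (hk s)
  -- While the cops travel, `m` bounds their remaining distances and the guards confine the robber;
  -- on arrival her side is smaller, and the outer induction applies.
  have walk : ∀ (m : ℕ) (C₁ : Fin k → V) (v₁ : V), (∀ i, G.dist (C₁ i) (C' i) ≤ m) →
      (∀ x ∈ D.bag t, x ∈ D.bag s → ∃ i, C₁ i = x ∧ C' i = x) →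
      WalkIn G {x | ¬ (x ∈ D.bag t ∧ x ∈ D.bag s)} v v₁ → Wins G C₁ v₁ := by
    intro m
    induction m with
    | zero =>
      intro C₁ v₁ hdist _ hv₁
      obtain rfl : C₁ = C' := funext fun i => by
        simpa [hG.dist_eq_zero_iff] using hdist i
      by_cases hv₁s : v₁ ∈ D.bag s
      · exact .of_mem (hC' v₁ hv₁s)
      · exact ih _ (hn ▸ Set.ncard_lt_ncard (hs v₁ hv₁ hv₁s)) s v₁ C₁ rfl hC'
    | succ m ihm =>
      intro C₁ v₁ hdist hguard hv₁
      choose C₂ hmove hdist₂ hstay using fun i => exists_dist_le hG (hdist i)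
      have hguard₂ : ∀ x ∈ D.bag t, x ∈ D.bag s → ∃ i, C₂ i = x ∧ C' i = x := by
        intro x hxt hxs
        obtain ⟨i, hi, hi'⟩ := hguard x hxt hxs
        exact ⟨i, by rw [hstay i (hi.trans hi'.symm), hi'], hi'⟩
      refine Wins.of_copMove hmove fun v₂ ⟨p, hp⟩ => ihm C₂ v₂ hdist₂ hguard₂
        (hv₁.trans ⟨p, fun x hx hxts => ?_⟩)
      obtain ⟨i, hi, -⟩ := hguard₂ x hxts.1 hxts.2
      exact hp x hx i hi
  obtain ⟨m, hm⟩ := (Set.finite_range fun i => G.dist (C i) (C' i)).bddAbove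
  exact walk m C v (fun i => hm ⟨i, rfl⟩) hCC' (.refl fun h => hv h.1)

theorem exists_isWinning_of_treewidth [Fintype V] (hG : G.Connected) :
    ∃ σ : CopStrategy G (treewidth G + 1), σ.IsWinning := by
  classical
  obtain ⟨ι, _, D, hD⟩ := exists_treeDecomposition G
  have := hG.nonempty
  obtain ⟨t, -⟩ := D.vertex_mem (Classical.arbitrary V)
  obtain ⟨C, hC, -⟩ := exists_assignment (fun _ : Fin (treewidth G + 1) => Classical.arbitrary V)
    ∅ (D.bag t) (by simp) (hD t)
  exact exists_isWinning C fun v => D.wins hG hD _ t v C rfl hC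

theorem copNumber_le_treewidth_add_one [Fintype V] (hG : G.Connected) :
    copNumber G ≤ treewidth G + 1 :=
  Nat.sInf_le (exists_isWinning_of_treewidth hG)

theorem exists_isWinning_copNumber [Fintype V] (hG : G.Connected) :
    ∃ σ : CopStrategy G (copNumber G), σ.IsWinning :=
  Nat.sInf_mem (s := {k | ∃ σ : CopStrategy G k, σ.IsWinning})
    ⟨_, exists_isWinning_of_treewidth hG⟩

theorem treewidth_add_one_le_copNumber_mul [Fintype V] [DecidableRel G.Adj] (hG : G.Connected) :
    treewidth G + 1 ≤ copNumber G * (G.maxDegree + 1) := by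
  have := hG.nonempty
  obtain ⟨σ, hσ⟩ := exists_isWinning_copNumber hG
  exact hσ.treewidth_add_one_le

end Search

/-! ### Complete graphs -/

section Complete

/-- If every bag missed a vertex, a vertex missed by the next bag could be reached from `v` in at
most one step, and the sides would shrink forever. -/
theorem TreeDecomposition.exists_bag_eq_univ {V ι : Type*} [Finite ι] [Nonempty V]
    (D : TreeDecomposition (⊤ : SimpleGraph V) ι) : ∃ t, ∀ v, v ∈ D.bag t := by
  by_contra! hD
  have key : ∀ (n : ℕ) (t : ι) (v : V), v ∉ D.bag t → (D.side t v).ncard ≠ n := by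
    intro n
    induction n using Nat.strong_induction_on with
    | _ n ih =>
      rintro t v hv rfl
      obtain ⟨s, hs⟩ := D.exists_side_ssubset hv
      obtain ⟨v', hv'⟩ := hD s
      have hw : WalkIn ⊤ {x | ¬ (x ∈ D.bag t ∧ x ∈ D.bag s)} v v' := by
        by_cases h : v = v'
        · exact h ▸ .refl fun h => hv h.1
        · exact .of_adj ((SimpleGraph.top_adj _ _).mpr h) (fun h => hv h.1) fun h => hv' h.2
      exact ih _ (Set.ncard_lt_ncard (hs v' hw hv')) s v' hv' rfl
  obtain ⟨t, -⟩ := D.vertex_mem (Classical.arbitrary V)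
  obtain ⟨v, hv⟩ := hD t
  exact key _ t v hv rfl

theorem treewidth_top_add_one (V : Type*) [Fintype V] [Nonempty V] :
    treewidth (⊤ : SimpleGraph V) + 1 = Fintype.card V := by
  refine le_antisymm ?_ ?_
  · exact treewidth_add_one_le ((PartialDecomposition.single ⊤ Finset.univ).toTreeDecomposition
      fun v => Finset.mem_univ v) Fintype.card_pos fun _ => Finset.card_le_univ _
  · obtain ⟨ι, _, D, hD⟩ := exists_treeDecomposition (⊤ : SimpleGraph V)
    obtain ⟨t, ht⟩ := D.exists_bag_eq_univ
    rw [← Finset.card_univ, ← Finset.eq_univ_iff_forall.mpr ht]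
    exact hD t

theorem copNumber_top (V : Type*) [Fintype V] [Nonempty V] :
    copNumber (⊤ : SimpleGraph V) = 1 := by
  refine le_antisymm ?_ ?_
  · refine copNumber_le (fun _ => Classical.arbitrary V) fun v =>
      ⟨1, fun _ => v, fun _ => ?_, .inl ⟨0, rfl⟩⟩
    rw [SimpleGraph.top_adj, ne_comm]
    exact em _
  · exact (exists_isWinning_copNumber SimpleGraph.connected_top).elim fun σ hσ => hσ.pos

end Complete

/-! ### Branch vertices joined by paths of length three -/

section ThreePath

variable {m : ℕ}

/-- The branch vertex in whose closed neighbourhood a vertex lies. -/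
def home : ThreePathVertex m → Fin m
  | .inl i => i
  | .inr (p, _, false) => p.1.1
  | .inr (p, _, true) => p.1.2

/-- The number of the path on which an inner vertex lies (arbitrary on branch vertices). -/
def pathIndex : ThreePathVertex m → Fin m
  | .inl i => i
  | .inr (_, l, _) => l

theorem threePathGraph_adj {u v : ThreePathVertex m} :
    (threePathGraph m).Adj u v ↔ u ≠ v ∧ (threePathRel m u v ∨ threePathRel m v u) :=
  SimpleGraph.fromRel_adj _ _ _

theorem adj_home (p : {p : Fin m × Fin m // p.1 < p.2}) (l : Fin m) (b : Bool) :
    (threePathGraph m).Adj (.inl (home (.inr (p, l, b)))) (.inr (p, l, b)) := by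
  cases b <;> simp [threePathGraph_adj, threePathRel, home]

theorem adj_inner (p : {p : Fin m × Fin m // p.1 < p.2}) (l : Fin m) :
    (threePathGraph m).Adj (.inr (p, l, false)) (.inr (p, l, true)) := by
  simp [threePathGraph_adj, threePathRel]

/-- The fibres of `home` are the closed neighbourhoods of the branch vertices, so each cop threatens
only one branch vertex at a time. -/
theorem home_eq_of_adj {x : ThreePathVertex m} {i : Fin m}
    (h : (threePathGraph m).Adj x (.inl i)) : home x = i := by
  rcases x with j | ⟨p, l, _ | _⟩ <;> simp_all [threePathGraph_adj, threePathRel, home]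

/-- The `l`-th path between two branch vertices. -/
theorem walkIn_branch {i j : Fin m} (hij : i ≠ j) (l : Fin m) :
    WalkIn (threePathGraph m)
      {x | x = .inl i ∨ x = .inl j ∨ ∃ p b, x = .inr (p, l, b)} (.inl i) (.inl j) := by
  have key : ∀ p : {p : Fin m × Fin m // p.1 < p.2}, WalkIn (threePathGraph m)
      {x | x = .inl p.1.1 ∨ x = .inl p.1.2 ∨ ∃ p b, x = .inr (p, l, b)}
      (.inl p.1.1) (.inl p.1.2) := fun p =>
    .trans (.of_adj (adj_home p l false) (.inl rfl) (.inr (.inr ⟨p, false, rfl⟩)))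
      (.trans (.of_adj (adj_inner p l) (.inr (.inr ⟨p, false, rfl⟩)) (.inr (.inr ⟨p, true, rfl⟩)))
        (.of_adj (adj_home p l true).symm (.inr (.inr ⟨p, true, rfl⟩)) (.inr (.inl rfl))))
  rcases lt_or_gt_of_ne hij with h | h
  · exact key ⟨(i, j), h⟩
  · refine (key ⟨(j, i), h⟩).symm.mono fun x hx => ?_
    rcases hx with hx | hx | hx
    exacts [.inr (.inl hx), .inl hx, .inr (.inr hx)]

theorem threePathGraph_connected (hm : 0 < m) : (threePathGraph m).Connected := by
  have hhome : ∀ x, (threePathGraph m).Reachable (.inl (home x)) x := by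
    rintro (i | ⟨p, l, b⟩)
    · exact .rfl
    · exact (adj_home p l b).reachable
  have hbranch : ∀ i j : Fin m, (threePathGraph m).Reachable (.inl i) (.inl j) := by
    intro i j
    by_cases hij : i = j
    · exact hij ▸ .rfl
    · exact (walkIn_branch hij ⟨0, hm⟩).elim fun p _ => ⟨p⟩
  have : Nonempty (ThreePathVertex m) := ⟨.inl ⟨0, hm⟩⟩
  exact ⟨fun u v => (hhome u).symm.trans ((hbranch _ _).trans (hhome v))⟩

/-- The branch vertices form the central bag, the paths of length three the other bags. -/
def threePathBag (m : ℕ) :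
    Option ({p : Fin m × Fin m // p.1 < p.2} × Fin m) → Finset (ThreePathVertex m)
  | none => Finset.univ.image .inl
  | some (p, l) => {.inl p.1.1, .inl p.1.2, .inr (p, l, false), .inr (p, l, true)}

theorem inr_mem_threePathBag {p : {p : Fin m × Fin m // p.1 < p.2}} {l : Fin m} {b : Bool}
    {t : Option ({p : Fin m × Fin m // p.1 < p.2} × Fin m)} :
    .inr (p, l, b) ∈ threePathBag m t ↔ t = some (p, l) := by
  rcases t with _ | ⟨q, l'⟩ <;> cases b <;> simp [threePathBag, eq_comm]

theorem inl_home_mem_threePathBag (p : {p : Fin m × Fin m // p.1 < p.2}) (l l' : Fin m) (b : Bool) :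
    .inl (home (.inr (p, l', b))) ∈ threePathBag m (some (p, l)) := by
  cases b <;> simp [threePathBag, home]

theorem inl_mem_threePathBag_none (i : Fin m) : .inl i ∈ threePathBag m none := by
  simp [threePathBag]

/-- A tree decomposition whose tree is a star. -/
def threePathDecomposition (m : ℕ) : TreeDecomposition (threePathGraph m)
    (Option ({p : Fin m × Fin m // p.1 < p.2} × Fin m)) where
  tree := SimpleGraph.starGraph none
  isTree := SimpleGraph.isTree_starGraph none
  bag := threePathBag m
  vertex_mem := by
    rintro (i | ⟨p, l, b⟩)
    · exact ⟨none, inl_mem_threePathBag_none i⟩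
    · exact ⟨some (p, l), inr_mem_threePathBag.mpr rfl⟩
  edge_mem := by
    have hl : ∀ i p l b, (threePathGraph m).Adj (.inr (p, l, b)) (.inl i) →
        ∃ t, .inl i ∈ threePathBag m t ∧ .inr (p, l, b) ∈ threePathBag m t := fun i p l b h =>
      ⟨some (p, l), home_eq_of_adj h ▸ inl_home_mem_threePathBag p l l b,
        inr_mem_threePathBag.mpr rfl⟩
    rintro (i | ⟨p, l, b⟩) (j | ⟨q, l', b'⟩) h
    · exact ⟨none, inl_mem_threePathBag_none i, inl_mem_threePathBag_none j⟩
    · exact hl i q l' b' h.symm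
    · exact (hl j p l b h).imp fun _ h => h.symm
    · have hpq : p = q ∧ l = l' := by
        cases b <;> cases b' <;> simp [threePathGraph_adj, threePathRel] at h
        exacts [h, ⟨h.1.symm, h.2.symm⟩]
      obtain ⟨rfl, rfl⟩ := hpq
      exact ⟨some (p, l), inr_mem_threePathBag.mpr rfl, inr_mem_threePathBag.mpr rfl⟩
  subtree := by
    rintro (i | ⟨p, l, b⟩)
    · refine WalkIn.induce_connected_iff.mpr ⟨⟨none, inl_mem_threePathBag_none i⟩, ?_⟩
      have key : ∀ t, .inl i ∈ threePathBag m t → WalkIn (SimpleGraph.starGraph none)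
          {t | .inl i ∈ threePathBag m t} none t := by
        intro t ht
        by_cases h : none = t
        · exact h ▸ .refl (inl_mem_threePathBag_none i)
        · exact .of_adj (SimpleGraph.starGraph_center_adj h) (inl_mem_threePathBag_none i) ht
      exact fun u hu v hv => (key u hu).symm.trans (key v hv)
    · refine WalkIn.induce_connected_iff.mpr ⟨⟨some (p, l), inr_mem_threePathBag.mpr rfl⟩, ?_⟩
      intro u hu v hv
      obtain rfl := inr_mem_threePathBag.mp hu
      obtain rfl := inr_mem_threePathBag.mp hv
      exact .refl hu

/-- The bags of the paths have four vertices, whence the condition on `m`. -/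
theorem card_threePathBag_le (hm : 4 ≤ m) (t) : (threePathBag m t).card ≤ m := by
  rcases t with _ | ⟨p, l⟩
  · exact Finset.card_image_le.trans (by simp)
  · exact Finset.card_le_four.trans hm

theorem exists_notMem_range {k : ℕ} (hk : k < m) (f : Fin k → Fin m) : ∃ i, ∀ j, f j ≠ i := by
  by_contra! h
  have := Fintype.card_le_of_surjective f h
  simp only [Fintype.card_fin] at this
  omega

/-- Against fewer than `m` cops the robber moves between branch vertices whose closed
neighbourhoods contain no cops. -/
theorem CopStrategy.IsWinning.le_of_threePathGraph {k : ℕ} {σ : CopStrategy (threePathGraph m) k}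
    (hσ : σ.IsWinning) : m ≤ k := by
  by_contra! hk
  refine σ.not_isWinning (fun C v => ∃ i, v = .inl i ∧ ∀ j, home (C j) ≠ i) ?_ ?_ hσ
  · intro C
    obtain ⟨i, hi⟩ := exists_notMem_range hk fun j => home (C j)
    exact ⟨.inl i, i, rfl, hi⟩
  · rintro C C' _ ⟨i, rfl, hi⟩ hmove
    have hC'i : ∀ j, C' j ≠ .inl i := by
      intro j hj
      rcases hmove j with h | h
      · exact hi j (by rw [← h, hj]; rfl)
      · exact hi j (home_eq_of_adj (hj ▸ h))
    refine ⟨hC'i, ?_⟩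
    obtain ⟨w, hw⟩ := exists_notMem_range hk fun j => home (C' j)
    -- With fewer than `m` cops, some index `l` is free of cops on the paths of all pairs at once.
    obtain ⟨l, hl⟩ := exists_notMem_range hk fun j => pathIndex (C' j)
    refine ⟨.inl w, ?_, w, rfl, hw⟩
    by_cases hiw : i = w
    · subst hiw
      exact .of_walkIn (S := {.inl i}) (.refl rfl) hC'i
    · refine .of_walkIn (walkIn_branch hiw l) ?_
      rintro j (h | h | ⟨p, b, h⟩)
      · exact hC'i j h
      · exact hw j (by rw [h]; rfl)
      · exact hl j (by rw [h]; rfl)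

end ThreePath

end CopsRobber

theorem mainTheorem1 :
    (∀ (V : Type*) [Fintype V] (G : SimpleGraph V) [DecidableRel G.Adj], G.Connected →
      ((CopsRobber.treewidth G : ℝ) + 1) / ((G.maxDegree : ℝ) + 1) ≤ (CopsRobber.copNumber G : ℝ) ∧
      (CopsRobber.copNumber G : ℝ) ≤ (CopsRobber.treewidth G : ℝ) + 1) ∧
    (∀ n : ℕ, 1 ≤ n →
      CopsRobber.treewidth (⊤ : SimpleGraph (Fin n)) + 1 = n ∧
      (⊤ : SimpleGraph (Fin n)).maxDegree + 1 = n ∧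
      CopsRobber.copNumber (⊤ : SimpleGraph (Fin n)) = 1 ∧
      ((CopsRobber.treewidth (⊤ : SimpleGraph (Fin n)) : ℝ) + 1) /
          (((⊤ : SimpleGraph (Fin n)).maxDegree : ℝ) + 1) =
        (CopsRobber.copNumber (⊤ : SimpleGraph (Fin n)) : ℝ)) ∧
    (∀ m : ℕ, 4 ≤ m →
      (CopsRobber.threePathGraph m).Connected ∧
      CopsRobber.treewidth (CopsRobber.threePathGraph m) + 1 = m ∧
      CopsRobber.copNumber (CopsRobber.threePathGraph m) =
        CopsRobber.treewidth (CopsRobber.threePathGraph m) + 1) := by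
  refine ⟨?_, ?_, ?_⟩
  · intro V _ G _ hG
    constructor
    · rw [div_le_iff₀ (by positivity)]
      exact_mod_cast CopsRobber.treewidth_add_one_le_copNumber_mul hG
    · exact_mod_cast CopsRobber.copNumber_le_treewidth_add_one hG
  · intro n hn
    have : Nonempty (Fin n) := ⟨⟨0, hn⟩⟩
    have htw : CopsRobber.treewidth (⊤ : SimpleGraph (Fin n)) + 1 = n := by
      simpa using CopsRobber.treewidth_top_add_one (Fin n)
    have hdeg : (⊤ : SimpleGraph (Fin n)).maxDegree + 1 = n := by
      rw [SimpleGraph.IsRegularOfDegree.maxDegree_eq _ SimpleGraph.IsRegularOfDegree.top,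
        Fintype.card_fin]
      omega
    refine ⟨htw, hdeg, CopsRobber.copNumber_top (Fin n), ?_⟩
    rw [CopsRobber.copNumber_top (Fin n), ← Nat.cast_succ, ← Nat.cast_succ, Nat.succ_eq_add_one,
      Nat.succ_eq_add_one, htw, hdeg, div_self (by positivity), Nat.cast_one]
  · intro m hm
    have hconn := CopsRobber.threePathGraph_connected (m := m) (by omega)
    have htw := CopsRobber.treewidth_add_one_le (CopsRobber.threePathDecomposition m) (by omega)
      (CopsRobber.card_threePathBag_le hm)
    have hcop := CopsRobber.copNumber_le_treewidth_add_one hconn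
    obtain ⟨σ, hσ⟩ := CopsRobber.exists_isWinning_copNumber hconn
    have hle := hσ.le_of_threePathGraph
    -- The chain m ≤ c ≤ tw + 1 ≤ m forces equality throughout.
    exact ⟨hconn, by omega, by omega⟩
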